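/- For a lattice $L$ in a Euclidean space, let $\mathrm{O}(L)$ be the group of automorphisms of the abelian group $L$ that preserve the inner product; $L$ is called orientable if every element of $\mathrm{O}(L)$ has determinant $1$. For $n\geq 1$ let $\mathbf{A}_n$ be the root system $\{e_i-e_j \mid 1\leq i\neq j\leq n+1\}$ in $\mathbb{R}^{n+1}$, and for $k \geq 1$ let $k\,\mathbf{A}_n$ be the orthogonal sum of $k$ copies of $\mathbf{A}_n$. For a root system $R$, let $\mathrm{Q}(R)$ be the lattice generated by $R$; a Weyl vector of $R$ is the half-sum of the elements of a positive system of $R$. Define $$\mathrm{Q}_8=\{x\in \mathrm{Q}(2\,\mathbf{A}_4)\mid x\cdot\rho\equiv 0 \bmod 5\},\qquad \mathrm{Q}_6=\{x\in \mathrm{Q}(3\,\mathbf{A}_2)\mid x\cdot\rho\equiv 0 \bmod 3\},$$ where in each case $\rho$ is a Weyl vector of the root system in question. Then, for any choice of the Weyl vectors, the lattice $\mathrm{Q}_8$ is orientable, whereas the lattice $\mathrm{Q}_6$ is not. -/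

import Mathlib

open scoped RealInnerProductSpace

noncomputable section

namespace LatticeQ

variable {E : Type*} [NormedAddCommGroup E] [InnerProductSpace ℝ E]

/-- The orthogonal group `O(L)` of a lattice `L` in a Euclidean space: the group of automorphisms
of the abelian group `L` that preserve the inner product. -/
def orthogonalGroup (L : Submodule ℤ E) : Subgroup (L ≃ₗ[ℤ] L) where
  carrier := {g | ∀ x y : L, ⟪(g x : E), (g y : E)⟫ = ⟪(x : E), (y : E)⟫}
  one_mem' := fun _ _ => rfl
  mul_mem' := fun {a b} ha hb x y => (ha (b x) (b y)).trans (hb x y)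
  inv_mem' := fun {a} ha x y => by
    have h := ha (a⁻¹ x) (a⁻¹ y)
    have e : ∀ z : L, a (a⁻¹ z) = z := fun z => a.apply_symm_apply z
    rw [e, e] at h
    exact h.symm

/-- A lattice is orientable if every element of its orthogonal group has determinant `1`. -/
def Orientable (L : Submodule ℤ E) : Prop :=
  ∀ g ∈ orthogonalGroup L, LinearMap.det (g : L →ₗ[ℤ] L) = 1

/-- `ρ` is a Weyl vector of the (finite) root system `R`: the half-sum of the positive roots, for
some positive system of `R`, i.e. for the set of roots that are positive on some vector `v` which
is orthogonal to no root. -/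
def IsWeylVector (R : Set E) (ρ : E) : Prop :=
  ∃ v : E, (∀ α ∈ R, ⟪α, v⟫ ≠ 0) ∧ ρ = (1 / 2 : ℝ) • ∑ᶠ α ∈ {α ∈ R | 0 < ⟪α, v⟫}, α

/-- The sublattice of the root lattice `Q(R)` (the `ℤ`-span of `R`) formed by the `x` with
`x · ρ ≡ 0 mod p`. -/
def weylSublattice (R : Set E) (p : ℤ) (ρ : E) : Submodule ℤ E where
  carrier := {x | x ∈ Submodule.span ℤ R ∧ ∃ m : ℤ, ⟪x, ρ⟫ = (p : ℝ) * m}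
  zero_mem' := ⟨Submodule.zero_mem _, 0, by simp⟩
  add_mem' := by
    rintro x y ⟨hx, m, hm⟩ ⟨hy, n, hn⟩
    exact ⟨Submodule.add_mem _ hx hy, m + n, by rw [inner_add_left, hm, hn]; push_cast; ring⟩
  smul_mem' := by
    rintro c x ⟨hx, m, hm⟩
    refine ⟨Submodule.smul_mem _ c hx, c * m, ?_⟩
    rw [← Int.cast_smul_eq_zsmul ℝ c x, real_inner_smul_left, hm]
    push_cast
    ring

/-- The root system `k 𝐀ₙ₋₁`, orthogonal sum of `k` copies of
`𝐀ₙ₋₁ = {eᵢ - eⱼ | i ≠ j} ⊆ ℝⁿ`. -/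
def rootsA (k n : ℕ) : Set (EuclideanSpace ℝ (Fin k × Fin n)) :=
  {α | ∃ (c : Fin k) (i j : Fin n), i ≠ j ∧
    α = EuclideanSpace.single (c, i) (1 : ℝ) - EuclideanSpace.single (c, j) (1 : ℝ)}

/-- The lattice `Q₈`, built from the root lattice `A₄ ⊕ A₄` and a Weyl vector `ρ`. -/
def Q8 (ρ : EuclideanSpace ℝ (Fin 2 × Fin 5)) : Submodule ℤ (EuclideanSpace ℝ (Fin 2 × Fin 5)) :=
  weylSublattice (rootsA 2 5) 5 ρ

/-- The lattice `Q₆`, built from the root lattice `A₂ ⊕ A₂ ⊕ A₂` and a Weyl vector `ρ`. -/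
def Q6 (ρ : EuclideanSpace ℝ (Fin 3 × Fin 3)) : Submodule ℤ (EuclideanSpace ℝ (Fin 3 × Fin 3)) :=
  weylSublattice (rootsA 3 3) 3 ρ

/-- Weyl vectors exist. -/
theorem exists_isWeylVector (k n : ℕ) : ∃ ρ, IsWeylVector (rootsA k n) ρ := by
  refine ⟨_, WithLp.toLp 2 (fun a => (a.2.val : ℝ)), ?_, rfl⟩
  rintro α ⟨c, i, j, hij, rfl⟩
  have hne : (i.val : ℝ) - (j.val : ℝ) ≠ 0 := by
    rw [sub_ne_zero]
    exact_mod_cast fun h => hij (Fin.ext h)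
  simpa [inner_sub_left, EuclideanSpace.inner_single_left] using hne

end LatticeQ

end

noncomputable section

namespace LatticeQ

/-! In each block, the coordinates of a Weyl vector are `0, …, n - 1` in some order, all lowered by
`(n - 1) / 2`. The constant pairs to zero with the root lattice. So permuting coordinates inside the
blocks turns the lattice, whatever the Weyl vector, into one model: integer vectors with zero block
sums and `p ∣ ∑ i * z i` (`orientable_weylSublattice_iff`).

For `Q6`, negating and reversing one block preserves the model. It is a reflection of the plane of
that block and the identity on the others, so its determinant is `-1`.

For `Q8` the proof is a finite computation. The vectors of norm 4 are the 120 members of `orbitA ++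
orbitB`. An isometry is determined by the images of the eight independent vectors of `frame`, and
these images have norm 4 and the same Gram matrix. Composing with explicit symmetries of determinant
1 modulo 3 (`IsSymmetry.good`) brings the first image to `rootA` or `rootB`. A backtracking search
over the remaining images (`search_frame`) always finds the coordinate determinant of `frame` modulo
3. Hence the determinant of the isometry is 1 modulo 3; being `1` or `-1`, it is `1`. -/

/-! ### Coordinates of Weyl vectors. -/

theorem single_sub_single_injOn {ι : Type*} [Fintype ι] [DecidableEq ι] {a b a' b' : ι}
    (hab : a ≠ b)
    (h : EuclideanSpace.single a (1 : ℝ) - EuclideanSpace.single b (1 : ℝ) =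
      EuclideanSpace.single a' (1 : ℝ) - EuclideanSpace.single b' (1 : ℝ)) : a = a' ∧ b = b' := by
  have ha := congrArg (fun x : EuclideanSpace ℝ ι => x a) h
  have hb := congrArg (fun x : EuclideanSpace ℝ ι => x b) h
  simp only [PiLp.sub_apply, PiLp.single_apply, if_true, if_neg hab, if_neg hab.symm]
    at ha hb
  constructor
  · by_contra hne
    rw [if_neg hne] at ha
    split_ifs at ha <;> norm_num at ha
  · by_contra hne
    rw [if_neg hne] at hb
    split_ifs at hb <;> norm_num at hb

theorem card_lt_add_card_gt {n : ℕ} {f : Fin n → ℝ} (hf : Function.Injective f) (i : Fin n) :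
    (Finset.univ.filter fun j => f j < f i).card + (Finset.univ.filter fun j => f i < f j).card + 1
      = n := by
  have h1 : Disjoint (Finset.univ.filter fun j => f j < f i)
      (Finset.univ.filter fun j => f i < f j) := by
    rw [Finset.disjoint_filter]
    intro j _ h h'
    exact lt_asymm h h'
  have h2 : (Finset.univ.filter fun j => f j < f i) ∪ (Finset.univ.filter fun j => f i < f j) =
      Finset.univ.erase i := by
    ext j
    simp only [Finset.mem_union, Finset.mem_filter, Finset.mem_univ, true_and, Finset.mem_erase,
      and_true]
    rw [lt_or_lt_iff_ne, hf.ne_iff]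
  rw [← Finset.card_union_of_disjoint h1, h2, Finset.card_erase_of_mem (Finset.mem_univ i),
    Finset.card_univ, Fintype.card_fin]
  have := i.pos
  omega

/-- The number of indices at which an injective function on `Fin n` takes a smaller value is a
permutation of `Fin n`. -/
theorem exists_rank_perm {n : ℕ} {f : Fin n → ℝ} (hf : Function.Injective f) :
    ∃ r : Equiv.Perm (Fin n), ∀ i, (r i : ℕ) = (Finset.univ.filter fun j => f j < f i).card := by
  have hlt : ∀ i, (Finset.univ.filter fun j => f j < f i).card < n := fun i => by
    have := card_lt_add_card_gt hf i
    omega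
  have hmono : ∀ i j, f i < f j → (Finset.univ.filter fun l => f l < f i).card <
      (Finset.univ.filter fun l => f l < f j).card := by
    intro i j hij
    apply Finset.card_lt_card
    refine (Finset.ssubset_iff_of_subset ?_).2 ⟨i, by simpa using hij, by simp⟩
    intro l hl
    simp only [Finset.mem_filter, Finset.mem_univ, true_and] at hl ⊢
    exact hl.trans hij
  have hinj : Function.Injective fun i : Fin n =>
      (⟨(Finset.univ.filter fun j => f j < f i).card, hlt i⟩ : Fin n) := by
    intro i j hij
    have h := congrArg Fin.val hij
    by_contra hne
    rcases lt_or_gt_of_ne (hf.ne hne) with h' | h'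
    · exact (hmono i j h').ne h
    · exact (hmono j i h').ne' h
  exact ⟨Equiv.ofBijective _ (Finite.injective_iff_bijective.1 hinj), fun i => rfl⟩

/-- No root is orthogonal to `v`, so `v` has distinct coordinates in each block. The coordinate of
`ρ` at `(c, i)` is half of (number of smaller coordinates minus number of larger ones), and these
two numbers add up to `n - 1`. -/
theorem IsWeylVector.exists_perm {k n : ℕ} {ρ : EuclideanSpace ℝ (Fin k × Fin n)}
    (h : IsWeylVector (rootsA k n) ρ) :
    ∃ r : Fin k → Equiv.Perm (Fin n), ∀ c i, ρ (c, i) = (r c i : ℕ) - ((n : ℝ) - 1) / 2 := by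
  obtain ⟨v, hv, rfl⟩ := h
  have hval : ∀ c i j, ⟪EuclideanSpace.single (c, i) (1 : ℝ) -
      EuclideanSpace.single (c, j) (1 : ℝ), v⟫ = v (c, i) - v (c, j) := by
    intro c i j
    simp [inner_sub_left, EuclideanSpace.inner_single_left]
  have hinj : ∀ c, Function.Injective fun i => v (c, i) := by
    intro c i j hij
    by_contra hne
    apply hv _ ⟨c, i, j, hne, rfl⟩
    rw [hval, sub_eq_zero]
    exact hij
  choose r hr using fun c => exists_rank_perm (hinj c)
  refine ⟨r, fun c i => ?_⟩
  set S : Finset (Fin k × Fin n × Fin n) :=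
    Finset.univ.filter fun t => v (t.1, t.2.2) < v (t.1, t.2.1) with hS
  set F : Fin k × Fin n × Fin n → EuclideanSpace ℝ (Fin k × Fin n) := fun t =>
    EuclideanSpace.single (t.1, t.2.1) (1 : ℝ) - EuclideanSpace.single (t.1, t.2.2) (1 : ℝ) with hF
  have himg : {α ∈ rootsA k n | 0 < ⟪α, v⟫} = F '' (S : Set _) := by
    ext α
    constructor
    · rintro ⟨⟨c, i, j, hij, rfl⟩, hpos⟩
      rw [hval, sub_pos] at hpos
      exact ⟨(c, i, j), by simpa [hS] using hpos, rfl⟩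
    · rintro ⟨⟨c, i, j⟩, ht, rfl⟩
      have ht' : v (c, j) < v (c, i) := by simpa [hS] using ht
      refine ⟨⟨c, i, j, ?_, rfl⟩, ?_⟩
      · rintro rfl
        exact lt_irrefl _ ht'
      · rw [hF, hval, sub_pos]
        exact ht'
  have hFinj : Set.InjOn F (S : Set _) := by
    rintro ⟨c, i, j⟩ ht ⟨c', i', j'⟩ _ heq
    have ht' : v (c, j) < v (c, i) := by simpa [hS] using ht
    have hne : ((c, i) : Fin k × Fin n) ≠ (c, j) := by
      intro h
      rw [h] at ht'
      exact lt_irrefl _ ht'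
    obtain ⟨h1, h2⟩ := single_sub_single_injOn hne heq
    simp only [Prod.mk.injEq] at h1 h2 ⊢
    exact ⟨h1.1, h1.2, h2.2⟩
  rw [himg, finsum_mem_image hFinj, finsum_mem_coe_finset]
  have hsum : (∑ t ∈ S, F t) (c, i) =
      ((Finset.univ.filter fun j => v (c, j) < v (c, i)).card : ℝ) -
        (Finset.univ.filter fun j => v (c, i) < v (c, j)).card := by
    have hcoord : (∑ t ∈ S, F t) (c, i) = ∑ t ∈ S, (F t) (c, i) := by
      simp
    rw [hcoord, hS, Finset.sum_filter, Fintype.sum_prod_type]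
    simp only [Fintype.sum_prod_type, hF, PiLp.sub_apply, PiLp.single_apply,
      Prod.mk.injEq]
    rw [Finset.sum_eq_single c]
    · simp only [true_and]
      have e : ∀ x y : Fin n, (if v (c, y) < v (c, x) then
          ((if i = x then (1 : ℝ) else 0) - if i = y then 1 else 0) else 0) =
          (if i = x then (if v (c, y) < v (c, x) then (1 : ℝ) else 0) else 0) -
          (if i = y then (if v (c, y) < v (c, x) then (1 : ℝ) else 0) else 0) := by
        intro x y
        split_ifs <;> simp
      simp only [e, Finset.sum_sub_distrib]
      -- Exchanging the sums in the first term lets each indicator collapse the sum over its own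
      -- index.
      rw [Finset.sum_comm]
      simp
    · intro c' _ hc'
      simp [hc'.symm]
    · simp
  have hcard := card_lt_add_card_gt (hinj c) i
  have hcard' : ((Finset.univ.filter fun j => v (c, j) < v (c, i)).card : ℝ) +
      (Finset.univ.filter fun j => v (c, i) < v (c, j)).card + 1 = n := by
    exact_mod_cast hcard
  rw [PiLp.smul_apply, hsum, hr c i, smul_eq_mul]
  linarith

/-! ### The integral model of the lattices. -/

theorem mem_span_rootsA {k n : ℕ} {x : EuclideanSpace ℝ (Fin k × Fin n)} :
    x ∈ Submodule.span ℤ (rootsA k n) ↔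
      ∃ z : Fin k × Fin n → ℤ, (∀ q, x q = z q) ∧ ∀ c, ∑ i, z (c, i) = 0 := by
  constructor
  · intro hx
    induction hx using Submodule.span_induction with
    | mem x hx =>
      obtain ⟨c, i, j, _, rfl⟩ := hx
      refine ⟨fun q => (if q = (c, i) then 1 else 0) - (if q = (c, j) then 1 else 0), ?_, ?_⟩
      · intro q
        simp [PiLp.single_apply]
      · intro c'
        by_cases hc : c' = c <;> simp [hc]
    | zero => exact ⟨0, by simp, by simp⟩
    | add x y _ _ hx hy =>
      obtain ⟨z, hz, hz'⟩ := hx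
      obtain ⟨w, hw, hw'⟩ := hy
      exact ⟨z + w, by simp [hz, hw], by simp [Finset.sum_add_distrib, hz', hw']⟩
    | smul a x _ hx =>
      obtain ⟨z, hz, hz'⟩ := hx
      refine ⟨a • z, fun q => ?_, fun c => ?_⟩
      · rw [← Int.cast_smul_eq_zsmul ℝ]
        simp [hz]
      · simp [← Finset.mul_sum, hz']
  · rintro ⟨z, hz, hz'⟩
    rcases n with _ | n
    · have : x = 0 := by
        ext q
        exact q.2.elim0
      rw [this]
      exact Submodule.zero_mem _
    -- The subtracted multiples of the vector at index `0` cancel because the block sums vanish.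
    have hx : x = ∑ c, ∑ i, z (c, i) •
        (EuclideanSpace.single (c, i) (1 : ℝ) - EuclideanSpace.single (c, (0 : Fin (n + 1))) 1) := by
      ext ⟨c, i⟩
      have hz0 : ∑ j, (z (c, j) : ℝ) = 0 := by exact_mod_cast hz' c
      simp only [← Int.cast_smul_eq_zsmul ℝ, WithLp.ofLp_sum, Finset.sum_apply, PiLp.smul_apply,
        PiLp.sub_apply, PiLp.single_apply, Prod.mk.injEq, smul_eq_mul]
      rw [Finset.sum_eq_single c]
      · simp only [true_and, mul_sub, Finset.sum_sub_distrib, ← Finset.sum_mul, hz0]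
        simp [hz]
      · intro c' _ hc'
        simp [hc'.symm]
      · simp
    rw [hx]
    refine Submodule.sum_mem _ fun c _ => Submodule.sum_mem _ fun i _ =>
      Submodule.smul_mem _ _ ?_
    by_cases hi : i = 0
    · simp [hi]
    · exact Submodule.subset_span ⟨c, i, 0, hi, rfl⟩

/-- Integral coordinates on `weylSublattice (rootsA k n) p ρ`, for the Weyl vector `ρ` whose
coordinates are increasing in each block. -/
def modelLattice (k n : ℕ) (p : ℤ) : Submodule ℤ (Fin k × Fin n → ℤ) where
  carrier := {z | (∀ c, ∑ i, z (c, i) = 0) ∧ p ∣ ∑ c, ∑ i : Fin n, (i.val : ℤ) * z (c, i)}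
  zero_mem' := ⟨by simp, by simp⟩
  add_mem' := by
    rintro x y ⟨hx, hx'⟩ ⟨hy, hy'⟩
    refine ⟨fun c => by simp [Finset.sum_add_distrib, hx, hy], ?_⟩
    simpa [mul_add, Finset.sum_add_distrib] using dvd_add hx' hy'
  smul_mem' := by
    rintro a x ⟨hx, hx'⟩
    refine ⟨fun c => by simp [← Finset.mul_sum, hx], ?_⟩
    simpa [mul_left_comm _ a, ← Finset.mul_sum] using hx'.mul_left a

/-- The standard bilinear form on `modelLattice k n p`. -/
def modelForm (k n : ℕ) (p : ℤ) :
    modelLattice k n p →ₗ[ℤ] modelLattice k n p →ₗ[ℤ] ℤ :=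
  LinearMap.mk₂ ℤ (fun x y => ∑ q, (x : Fin k × Fin n → ℤ) q * (y : Fin k × Fin n → ℤ) q)
    (by intros; simp [add_mul, Finset.sum_add_distrib])
    (by intros; simp [Finset.mul_sum, mul_assoc])
    (by intros; simp [mul_add, Finset.sum_add_distrib])
    (by intros; simp [Finset.mul_sum, mul_left_comm])

theorem modelForm_apply {k n : ℕ} {p : ℤ} (x y : modelLattice k n p) :
    modelForm k n p x y = ∑ q, (x : Fin k × Fin n → ℤ) q * (y : Fin k × Fin n → ℤ) q := rfl

/-- The isometry onto `weylSublattice (rootsA k n) p ρ`, as a map to the ambient space. -/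
def modelEmbedding {k n : ℕ} (p : ℤ) (r : Fin k → Equiv.Perm (Fin n)) :
    modelLattice k n p →ₗ[ℤ] EuclideanSpace ℝ (Fin k × Fin n) where
  toFun z := WithLp.toLp 2 fun q => ((z : Fin k × Fin n → ℤ) (q.1, r q.1 q.2) : ℝ)
  map_add' x y := by
    ext q
    simp
  map_smul' a x := by
    ext q
    simp [← Int.cast_smul_eq_zsmul ℝ]

theorem modelEmbedding_apply {k n : ℕ} (p : ℤ) (r : Fin k → Equiv.Perm (Fin n))
    (z : modelLattice k n p) (q : Fin k × Fin n) :
    modelEmbedding p r z q = (z : Fin k × Fin n → ℤ) (q.1, r q.1 q.2) := rfl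

theorem inner_modelEmbedding {k n : ℕ} (p : ℤ) (r : Fin k → Equiv.Perm (Fin n))
    (x y : modelLattice k n p) :
    ⟪modelEmbedding p r x, modelEmbedding p r y⟫ = modelForm k n p x y := by
  rw [modelForm_apply, PiLp.inner_apply, Fintype.sum_prod_type, Fintype.sum_prod_type]
  push_cast
  refine Finset.sum_congr rfl fun c _ => ?_
  rw [← Equiv.sum_comp (r c) fun i => ((x : Fin k × Fin n → ℤ) (c, i) : ℝ) *
    (y : Fin k × Fin n → ℤ) (c, i)]
  refine Finset.sum_congr rfl fun i _ => ?_
  rw [modelEmbedding_apply, modelEmbedding_apply]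
  simp [mul_comm]

/-- The constant `(n - 1) / 2` contributes a multiple of each block sum, that is, nothing. -/
theorem inner_eq_sum_of_perm {k n : ℕ} {ρ : EuclideanSpace ℝ (Fin k × Fin n)}
    {r : Fin k → Equiv.Perm (Fin n)}
    (hr : ∀ c i, ρ (c, i) = (r c i : ℕ) - ((n : ℝ) - 1) / 2)
    {x : EuclideanSpace ℝ (Fin k × Fin n)} {z : Fin k × Fin n → ℤ}
    (hx : ∀ c i, x (c, i) = z (c, r c i)) (hz : ∀ c, ∑ i, z (c, i) = 0) :
    ⟪x, ρ⟫ = ((∑ c, ∑ i : Fin n, (i.val : ℤ) * z (c, i) : ℤ) : ℝ) := by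
  rw [PiLp.inner_apply, Fintype.sum_prod_type]
  push_cast
  refine Finset.sum_congr rfl fun c _ => ?_
  have hz0 : ∑ i, (z (c, i) : ℝ) = 0 := by exact_mod_cast hz c
  have h1 : ∀ i, inner ℝ (x (c, i)) (ρ (c, i)) =
      ((r c i : ℕ) : ℝ) * z (c, r c i) - ((n : ℝ) - 1) / 2 * z (c, r c i) := by
    intro i
    rw [hx, hr]
    simp
    ring
  simp only [h1]
  rw [Equiv.sum_comp (r c) (fun i : Fin n => ((i : ℕ) : ℝ) * z (c, i) - ((n : ℝ) - 1) / 2 * z (c, i)),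
    Finset.sum_sub_distrib, ← Finset.mul_sum, hz0, mul_zero, sub_zero]

theorem range_modelEmbedding {k n : ℕ} (p : ℤ) {ρ : EuclideanSpace ℝ (Fin k × Fin n)}
    {r : Fin k → Equiv.Perm (Fin n)}
    (hr : ∀ c i, ρ (c, i) = (r c i : ℕ) - ((n : ℝ) - 1) / 2) :
    LinearMap.range (modelEmbedding p r) = weylSublattice (rootsA k n) p ρ := by
  ext x
  constructor
  · rintro ⟨⟨z, hz, hz'⟩, rfl⟩
    refine ⟨mem_span_rootsA.2 ⟨fun q => z (q.1, r q.1 q.2), fun q => rfl, fun c => ?_⟩, ?_⟩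
    · rw [← hz c]
      exact Equiv.sum_comp (r c) fun i => z (c, i)
    · obtain ⟨m, hm⟩ := hz'
      refine ⟨m, ?_⟩
      rw [inner_eq_sum_of_perm hr (z := z) (fun c i => rfl) hz, hm]
      push_cast
      rfl
  · rintro ⟨hx, m, hm⟩
    obtain ⟨w, hw, hw'⟩ := mem_span_rootsA.1 hx
    have hz : ∀ c, ∑ i, w (c, (r c).symm i) = 0 := fun c => by
      rw [← hw' c]
      exact Equiv.sum_comp (r c).symm fun i => w (c, i)
    refine ⟨⟨fun q => w (q.1, (r q.1).symm q.2), hz, m, ?_⟩, ?_⟩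
    · rw [inner_eq_sum_of_perm hr (z := fun q => w (q.1, (r q.1).symm q.2))
        (fun c i => by simp [hw]) hz] at hm
      exact_mod_cast hm
    · ext q
      simp [modelEmbedding_apply, hw]

theorem modelEmbedding_injective {k n : ℕ} (p : ℤ) (r : Fin k → Equiv.Perm (Fin n)) :
    Function.Injective (modelEmbedding p r) := by
  intro x y h
  ext ⟨c, i⟩
  have := congrArg (fun u : EuclideanSpace ℝ (Fin k × Fin n) => u (c, (r c).symm i)) h
  simpa [modelEmbedding_apply] using this

/-- Orientability for an arbitrary Weyl vector, in integral coordinates. -/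
theorem orientable_weylSublattice_iff {k n : ℕ} (p : ℤ) {ρ : EuclideanSpace ℝ (Fin k × Fin n)}
    (hρ : IsWeylVector (rootsA k n) ρ) :
    Orientable (weylSublattice (rootsA k n) p ρ) ↔
      ∀ g : modelLattice k n p ≃ₗ[ℤ] modelLattice k n p,
        (∀ x y, modelForm k n p (g x) (g y) = modelForm k n p x y) →
        LinearMap.det (g : modelLattice k n p →ₗ[ℤ] modelLattice k n p) = 1 := by
  obtain ⟨r, hr⟩ := hρ.exists_perm
  set L := weylSublattice (rootsA k n) p ρ
  let e : modelLattice k n p ≃ₗ[ℤ] L :=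
    (LinearEquiv.ofInjective _ (modelEmbedding_injective p r)).trans
      (LinearEquiv.ofEq _ _ (range_modelEmbedding p hr))
  have he : ∀ x y, ⟪(e x : EuclideanSpace ℝ (Fin k × Fin n)), (e y : EuclideanSpace ℝ _)⟫ =
      modelForm k n p x y := inner_modelEmbedding p r
  constructor
  · intro h g hg
    have h1 := h ((e.symm.trans g).trans e) fun x y => by
      have := he (e.symm x) (e.symm y)
      rw [e.apply_symm_apply, e.apply_symm_apply] at this
      rw [this, ← hg, ← he]
      rfl
    rw [← h1]
    exact (LinearMap.det_conj (g : modelLattice k n p →ₗ[ℤ] modelLattice k n p) e).symm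
  · intro h g hg
    have h1 := h ((e.trans g).trans e.symm) fun x y => by
      have h2 : ∀ x, e (((e.trans g).trans e.symm) x) = g (e x) := fun x =>
        e.apply_symm_apply _
      have h3 := he (((e.trans g).trans e.symm) x) (((e.trans g).trans e.symm) y)
      rw [h2, h2, hg (e x) (e y), he] at h3
      exact_mod_cast h3.symm
    rw [← h1]
    exact (LinearMap.det_conj (g : L →ₗ[ℤ] L) e.symm).symm

/-! ### Determinants from coordinates, and their computation modulo 3. -/

/-- A linear endomorphism scales by its determinant the coordinate determinant of a family of
maximal rank. -/
theorem det_coord_comp {N J : Type*} [AddCommGroup N] [Fintype J] [DecidableEq J]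
    (κ : N →ₗ[ℤ] (J → ℤ)) (hκ : Function.Injective κ) (b : J → N)
    (hb : (Matrix.of fun i j => κ (b i) j).det ≠ 0) (f : N →ₗ[ℤ] N) :
    (Matrix.of fun i j => κ (f (b i)) j).det =
      LinearMap.det f * (Matrix.of fun i j => κ (b i) j).det := by
  let e := LinearEquiv.ofInjective κ hκ
  have : Module.Free ℤ N := Module.Free.of_equiv e.symm
  have : Module.Finite ℤ N := Module.Finite.equiv e.symm
  let A : N [⋀^J]→ₗ[ℤ] ℤ := Matrix.detRowAlternating.compLinearMap κ
  have hA : ∀ v : J → N, A v = (Matrix.of fun i j => κ (v i) j).det := fun v => rfl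
  have hli : LinearIndependent ℤ b := by
    by_contra h
    exact hb ((hA b).symm.trans (A.map_linearDependent b h))
  have hle : Module.finrank ℤ N ≤ Fintype.card J := by
    have := LinearMap.finrank_le_finrank_of_injective hκ
    rwa [Module.finrank_fintype_fun_eq_card] at this
  have hcard : Module.finrank ℤ N = Fintype.card J :=
    le_antisymm hle hli.fintype_card_le_finrank
  let β : Module.Basis J ℤ N :=
    (Module.finBasisOfFinrankEq ℤ N hcard).reindex (Fintype.equivFin J).symm
  -- Alternating forms of top degree are multiples of `β.det`, which `f` scales by its determinant;
  -- `b` need not be a basis.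
  rw [← hA (fun i => f (b i)), ← hA b, A.eq_smul_basis_det β]
  have h := β.det_comp f b
  simp only [AlternatingMap.smul_apply, smul_eq_mul]
  rw [show (fun i => f (b i)) = f ∘ b from rfl, h]
  ring

/-- The determinant modulo `3` of a square matrix given by the list of its rows, by Gaussian
elimination. -/
def detModThree : ℕ → List (List ℤ) → ℤ
  | 0, _ => 1
  | _ + 1, [] => 0
  | m + 1, r :: rs =>
    let c := r.findIdx fun a => a % 3 != 0
    (-1) ^ c * r.getD c 0 *
      detModThree m (rs.map fun s =>
        (s.zipWith (fun x y => (x - s.getD c 0 * r.getD c 0 * y) % 3) r).eraseIdx c)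

theorem getD_eraseIdx (l : List ℤ) (c j : ℕ) :
    (l.eraseIdx c).getD j 0 = l.getD (if j < c then j else j + 1) 0 := by
  simp only [List.getD_eq_getElem?_getD, List.getElem?_eraseIdx]
  split_ifs <;> rfl

theorem getD_zipWith (F : ℤ → ℤ → ℤ) {s r : List ℤ} {j : ℕ} (hs : j < s.length)
    (hr : j < r.length) : (s.zipWith F r).getD j 0 = F (s.getD j 0) (r.getD j 0) := by
  rw [List.getD_eq_getElem _ _ (by rw [List.length_zipWith]; exact lt_min hs hr),
    List.getElem_zipWith, List.getD_eq_getElem s 0 hs, List.getD_eq_getElem r 0 hr]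

theorem intCast_emod_three (x : ℤ) : ((x % 3 : ℤ) : ZMod 3) = x := ZMod.intCast_mod x 3

/-- Clear the pivot column with the first row, then expand along that column. Nonvanishing of the
result ensures that every elimination step finds a pivot, so the singular case never arises. -/
theorem detModThree_eq_det (m : ℕ) (rows : List (List ℤ)) (hlen : rows.length = m)
    (hrow : ∀ r ∈ rows, r.length = m) (hne : (detModThree m rows : ZMod 3) ≠ 0) :
    (Matrix.of fun i j : Fin m => (((rows.getD i []).getD j 0 : ℤ) : ZMod 3)).det =
      detModThree m rows := by
  induction m generalizing rows with
  | zero => simp [detModThree]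
  | succ m ih =>
    rcases rows with _ | ⟨r, rs⟩
    · simp at hlen
    simp only [detModThree] at hne ⊢
    set c := r.findIdx fun a => a % 3 != 0 with hc
    set F : List ℤ → List ℤ := fun s =>
      (s.zipWith (fun x y => (x - s.getD c 0 * r.getD c 0 * y) % 3) r).eraseIdx c with hF
    push_cast at hne ⊢
    set a : ZMod 3 := ((r.getD c 0 : ℤ) : ZMod 3) with ha
    have hr : r.length = m + 1 := hrow r (by simp)
    have hrs : rs.length = m := by simpa using hlen
    have hs : ∀ s ∈ rs, s.length = m + 1 := fun s h => hrow s (by simp [h])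
    have ha0 : a ≠ 0 := fun h => hne (by rw [h]; ring)
    -- A nonzero element of `ZMod 3` is its own inverse, so elimination needs no division.
    have haa : a * a = 1 := by
      revert ha0
      generalize a = t
      revert t
      decide
    -- Without a pivot, `c` would be out of range and the default value would give `a = 0`.
    have hcm : c < m + 1 := by
      by_contra h
      apply ha0
      rw [ha, List.getD_eq_default _ _ (by omega)]
      rfl
    have hih := ih (rs.map F) (by simpa using hrs) (by
      intro t ht
      obtain ⟨s, hs', rfl⟩ := List.mem_map.1 ht
      have h1 := hs s hs'
      rw [hF]
      simp only
      rw [List.length_eraseIdx_of_lt] <;> simp [h1, hr, hcm])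
      (fun h => hne (by rw [h]; ring))
    rw [← hih]
    set M : Matrix (Fin (m + 1)) (Fin (m + 1)) (ZMod 3) :=
      Matrix.of fun i j => ((((r :: rs).getD i []).getD j 0 : ℤ) : ZMod 3) with hM
    let c' : Fin (m + 1) := ⟨c, hcm⟩
    have hM0 : M 0 c' = a := rfl
    let M' : Matrix (Fin (m + 1)) (Fin (m + 1)) (ZMod 3) :=
      Matrix.of fun i j => M i j - (if i = 0 then 0 else M i c' * a) * M 0 j
    have hdet : M.det = M'.det :=
      Matrix.det_eq_of_forall_row_eq_smul_add_const (fun i => if i = 0 then 0 else M i c' * a) 0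
        (by simp) (by
          intro i j
          simp [M'])
    rw [hdet, Matrix.det_succ_column M' c', Finset.sum_eq_single 0]
    · have h1 : M' 0 c' = a := by simp [M', hM0]
      rw [h1]
      have hsub : M'.submatrix (Fin.succAbove 0) c'.succAbove =
          Matrix.of fun i j : Fin m => ((((rs.map F).getD i []).getD j 0 : ℤ) : ZMod 3) := by
        ext i j
        have hi : (i : ℕ) < rs.length := by rw [hrs]; exact i.2
        have hri : (rs.map F).getD i [] = F (rs.getD i []) := by
          rw [List.getD_eq_getElem _ _ (by simpa using hi), List.getD_eq_getElem _ _ hi,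
            List.getElem_map]
        have hlen' : (rs.getD i []).length = m + 1 := by
          rw [List.getD_eq_getElem _ _ hi]
          exact hs _ (List.getElem_mem hi)
        have hj : ((c'.succAbove j : Fin (m + 1)) : ℕ) =
            if (j : ℕ) < c then (j : ℕ) else j + 1 := by
          simp only [Fin.succAbove, Fin.lt_def, c']
          split_ifs <;> simp_all
        have hjl := (c'.succAbove j).2
        have hFj : (F (rs.getD i [])).getD j 0 =
            ((rs.getD i []).getD (c'.succAbove j) 0 -
              (rs.getD i []).getD c 0 * r.getD c 0 * r.getD (c'.succAbove j) 0) % 3 := by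
          rw [hF, getD_eraseIdx, ← hj, getD_zipWith _ (hjl.trans_eq hlen'.symm) (hjl.trans_eq hr.symm)]
        simp only [Matrix.submatrix_apply, Matrix.of_apply, hri, hFj, M', M,
          Fin.succAbove_zero, Fin.succ_ne_zero, if_false, Fin.val_succ, Fin.val_zero,
          List.getD_cons_succ, List.getD_cons_zero, intCast_emod_three]
        push_cast
        rfl
      rw [hsub]
      simp [c']
    · intro i _ hi
      have : M' i c' = 0 := by
        simp only [M', Matrix.of_apply, if_neg hi, hM0, mul_assoc, haa]
        ring
      rw [this]
      ring
    · simp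

/-! ### A reflection of `Q6`. -/

/-- The negative of the order-reversing permutation of the first block. -/
def negReverse : (Fin 3 × Fin 3 → ℤ) →ₗ[ℤ] (Fin 3 × Fin 3 → ℤ) where
  toFun z q := if q.1 = 0 then -z (0, q.2.rev) else z q
  map_add' x y := by
    ext q
    dsimp only [Pi.add_apply]
    split_ifs <;> ring
  map_smul' a x := by
    ext q
    dsimp only [Pi.smul_apply, smul_eq_mul, RingHom.id_apply]
    split_ifs <;> ring

theorem negReverse_negReverse (z : Fin 3 × Fin 3 → ℤ) : negReverse (negReverse z) = z := by
  ext ⟨c, i⟩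
  by_cases hc : c = 0 <;> simp [negReverse, hc]

theorem negReverse_mem {z : Fin 3 × Fin 3 → ℤ} (hz : z ∈ modelLattice 3 3 3) :
    negReverse z ∈ modelLattice 3 3 3 := by
  obtain ⟨h1, h2⟩ := hz
  have h10 := h1 0
  have h11 := h1 1
  have h12 := h1 2
  refine ⟨fun c => ?_, ?_⟩
  · fin_cases c <;> simp [negReverse, Fin.sum_univ_three, Fin.rev] at * <;> omega
  · simp [negReverse, Fin.sum_univ_three, Fin.rev] at *
    omega

/-- `negReverse` as an automorphism of the model of `Q₆`. -/
def negReverseEquiv : modelLattice 3 3 3 ≃ₗ[ℤ] modelLattice 3 3 3 :=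
  LinearEquiv.ofInvolutive (negReverse.restrict fun _ => negReverse_mem) fun z =>
    Subtype.ext (negReverse_negReverse z)

theorem coe_negReverseEquiv (z : modelLattice 3 3 3) :
    (negReverseEquiv z : Fin 3 × Fin 3 → ℤ) = negReverse z := rfl

/-- The coordinates of the model of `Q₆` other than the first one of each block. -/
def coordsSix : modelLattice 3 3 3 →ₗ[ℤ] (Fin 2 × Fin 3 → ℤ) where
  toFun z q := (z : Fin 3 × Fin 3 → ℤ) (q.2, q.1.succ)
  map_add' _ _ := rfl
  map_smul' _ _ := rfl

theorem coordsSix_injective : Function.Injective coordsSix := by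
  rw [← LinearMap.ker_eq_bot, LinearMap.ker_eq_bot']
  rintro ⟨z, hz, hz'⟩ h
  ext ⟨c, i⟩
  have h1 : z (c, 1) = 0 := congrFun h (0, c)
  have h2 : z (c, 2) = 0 := congrFun h (1, c)
  have h3 := hz c
  rw [Fin.sum_univ_three, h1, h2] at h3
  fin_cases i
  · simpa using h3
  · exact h1
  · exact h2

/-- Eigenvectors of `negReverse` of full rank in the model of `Q₆`. -/
def familySix (q : Fin 2 × Fin 3) : modelLattice 3 3 3 :=
  -- Within a block, `(1, -2, 1)` is negated by the reversal with sign and `(-1, 0, 1)` is fixed.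
  -- The latter is tripled to satisfy the congruence modulo 3.
  ⟨fun s => if s.1 = q.2 then ![![1, -2, 1], ![-3, 0, 3]] q.1 s.2 else 0, by
    revert q
    change ∀ q : Fin 2 × Fin 3, _ ∧ _
    decide⟩

theorem negReverse_familySix (q : Fin 2 × Fin 3) :
    negReverseEquiv (familySix q) = (if q = (0, 0) then -1 else 1 : ℤ) • familySix q := by
  ext s
  rw [coe_negReverseEquiv]
  change negReverse _ s = (if q = (0, 0) then -1 else 1 : ℤ) * _
  revert q s
  decide

theorem det_familySix_ne_zero :
    (Matrix.of fun i j => coordsSix (familySix i) j).det ≠ 0 := by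
  have h : (Matrix.of fun i j => coordsSix (familySix i) j) =
      Matrix.blockDiagonal fun _ : Fin 3 => !![-2, 1; 0, 3] := by
    ext i j
    rw [Matrix.of_apply, Matrix.blockDiagonal_apply]
    revert i j
    decide
  rw [h, Matrix.det_blockDiagonal]
  simp [Matrix.det_fin_two]

theorem not_orientable_Q6 {ρ : EuclideanSpace ℝ (Fin 3 × Fin 3)}
    (hρ : IsWeylVector (rootsA 3 3) ρ) : ¬ Orientable (Q6 ρ) := by
  rw [Q6, orientable_weylSublattice_iff 3 hρ]
  intro h
  have h1 := h negReverseEquiv fun x y => by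
    simp only [modelForm_apply, coe_negReverseEquiv, Fintype.sum_prod_type, Fin.sum_univ_three]
    simp [negReverse, Fin.rev]
    ring
  have h2 := det_coord_comp coordsSix coordsSix_injective familySix det_familySix_ne_zero
    negReverseEquiv
  -- Only one row changes sign, so a determinant of `1` would make a nonzero number equal to its
  -- opposite.
  have h3 := Matrix.det_mul_column (fun q : Fin 2 × Fin 3 => (if q = (0, 0) then -1 else 1 : ℤ))
    (Matrix.of fun i j => coordsSix (familySix i) j)
  rw [h1, one_mul] at h2
  simp only [LinearEquiv.coe_coe, negReverse_familySix, map_smul, Pi.smul_apply, smul_eq_mul] at h2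
  simp only [Matrix.of_apply] at h3
  rw [h2, Finset.prod_ite_eq' Finset.univ (0, 0) fun _ => (-1 : ℤ)] at h3
  have := det_familySix_ne_zero
  simp only [Finset.mem_univ, if_true] at h3
  omega

/-! ### Backtracking search with prescribed dot products. -/

/-- The dot product of two lists of integers. -/
def dot : List ℤ → List ℤ → ℤ
  | a :: x, b :: y => a * b + dot x y
  | _, _ => 0

/-- Backtracking search over the sequences of vectors that have the same pairwise dot products as
a given sequence, with a list of candidates for each term: does `leaf` hold for all of them? -/
def search (leaf : List (List ℤ) → Bool) :
    ℕ → List (List ℤ) → List (List ℤ × List (List ℤ)) → Bool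
  | 0, acc, _ => leaf acc
  | _ + 1, acc, [] => leaf acc
  | m + 1, acc, (b, C) :: rest => C.all fun w =>
      search leaf m (acc ++ [w])
        (rest.map fun s => (s.1, s.2.filter fun t => dot t w == dot s.1 b))

/-- In a triple of `l`, the last entry is an actual image of the first. The actual images survive
every filtering, so they form one of the branches explored. -/
theorem leaf_of_search {leaf : List (List ℤ) → Bool} (m : ℕ) (acc : List (List ℤ))
    (l : List (List ℤ × List (List ℤ) × List ℤ)) (hlen : l.length = m)
    (hmem : ∀ s ∈ l, s.2.2 ∈ s.2.1)
    (hdot : l.Pairwise fun s t => dot t.2.2 s.2.2 = dot t.1 s.1)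
    (h : search leaf m acc (l.map fun s => (s.1, s.2.1)) = true) :
    leaf (acc ++ l.map fun s => s.2.2) = true := by
  induction m generalizing acc l with
  | zero =>
    rw [List.length_eq_zero_iff] at hlen
    subst hlen
    simpa [search] using h
  | succ m ih =>
    rcases l with _ | ⟨⟨b, C, w⟩, l⟩
    · simp at hlen
    rw [List.pairwise_cons] at hdot
    simp only [List.map_cons, search, List.all_eq_true] at h
    have h1 := ih (acc ++ [w])
      (l.map fun s => (s.1, s.2.1.filter fun t => dot t w == dot s.1 b, s.2.2))
      (by simpa using hlen)
      (by
        intro s hs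
        obtain ⟨t, ht, rfl⟩ := List.mem_map.1 hs
        simp only [List.mem_filter, beq_iff_eq]
        exact ⟨hmem t (by simp [ht]), hdot.1 t ht⟩)
      (by
        rw [List.pairwise_map]
        exact hdot.2)
      (by simpa [Function.comp_def] using h w (hmem (b, C, w) (by simp)))
    simpa [Function.comp_def] using h1

/-! ### Explicit symmetries and vectors of norm 4 for `Q8`. -/

/-- The signed coordinate map given by the list of the signs and of the indices. -/
def act (σ : List (ℤ × ℕ)) (v : List ℤ) : List ℤ := σ.map fun s => s.1 * v.getD s.2 0

/-- The vectors `Sʲ v` for `j < m` and `v` in `R`. -/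
def expand (S : List ℤ → List ℤ) (m : ℕ) (R : List (List ℤ)) : List (List ℤ) :=
  R.flatMap fun v => (List.range m).map fun j => S^[j] v

/-- Since `S^[m]` fixes `v`, applying `S` another `m - j` times to `S^[j] v` returns to `v`, from
which `P` is pulled back. -/
theorem forall_expand {P : List ℤ → Prop} {S : List ℤ → List ℤ} (hP : ∀ v, P (S v) → P v)
    {m : ℕ} {R : List (List ℤ)} (hR : ∀ v ∈ R, P v) (hS : ∀ v ∈ R, S^[m] v = v) :
    ∀ v ∈ expand S m R, P v := by
  have hit : ∀ j v, P (S^[j] v) → P v := by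
    intro j
    induction j with
    | zero => exact fun v h => h
    | succ j ih => exact fun v h => hP v (ih (S v) h)
  intro v hv
  simp only [expand, List.mem_flatMap, List.mem_map, List.mem_range] at hv
  obtain ⟨w, hw, j, hj, rfl⟩ := hv
  apply hit (m - j)
  rw [← Function.iterate_add_apply, Nat.sub_add_cancel hj.le, hS w hw]
  exact hR w hw

/-- Cyclic shift of the first block. -/
def shiftLeft : List (ℤ × ℕ) :=
  [(1, 1), (1, 2), (1, 3), (1, 4), (1, 0), (1, 5), (1, 6), (1, 7), (1, 8), (1, 9)]

/-- Cyclic shift of the second block. -/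
def shiftRight : List (ℤ × ℕ) :=
  [(1, 0), (1, 1), (1, 2), (1, 3), (1, 4), (1, 6), (1, 7), (1, 8), (1, 9), (1, 5)]

/-- Multiplication of the indices by `2` modulo `5` in both blocks. -/
def doubleIndex : List (ℤ × ℕ) :=
  [(1, 0), (1, 2), (1, 4), (1, 1), (1, 3), (1, 5), (1, 7), (1, 9), (1, 6), (1, 8)]

/-- Change of sign of the first block and of its indices modulo `5`. -/
def negLeft : List (ℤ × ℕ) :=
  [(-1, 0), (-1, 4), (-1, 3), (-1, 2), (-1, 1), (1, 5), (1, 6), (1, 7), (1, 8), (1, 9)]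

/-- Exchange of the two blocks. -/
def swapBlocks : List (ℤ × ℕ) :=
  [(1, 5), (1, 6), (1, 7), (1, 8), (1, 9), (1, 0), (1, 1), (1, 2), (1, 3), (1, 4)]

def rootA : List ℤ := [0, 1, -1, -1, 1, 0, 0, 0, 0, 0]

def rootB : List ℤ := [1, -1, 0, 0, 0, -1, 1, 0, 0, 0]

def orbitA : List (List ℤ) :=
  expand (act swapBlocks) 2 (expand (act negLeft) 2 (expand (act shiftLeft) 5 [rootA]))

def orbitB : List (List ℤ) :=
  expand (act shiftRight) 5 (expand (act shiftLeft) 5 (expand (act doubleIndex) 4 [rootB]))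

/-- Eight independent minimal vectors. -/
def frame : List (List ℤ) :=
  [[0, 1, -1, -1, 1, 0, 0, 0, 0, 0],
   [1, -1, 0, 0, 0, 0, 0, -1, 1, 0],
   [-1, 1, 0, 0, 0, 0, 0, 0, 1, -1],
   [1, 0, -1, 0, 0, 0, 1, 0, 0, -1],
   [-1, 0, 1, 0, 0, 1, 0, -1, 0, 0],
   [0, 0, -1, 0, 1, 0, 1, 0, -1, 0],
   [-1, 0, 1, 0, 0, 0, 0, 1, 0, -1],
   [0, 0, 1, 0, -1, 0, 1, 0, 0, -1]]

/-- The first coordinate of each of the two blocks is removed. -/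
def dropFirst (w : List ℤ) : List ℤ := (w.eraseIdx 5).tail

/-- Do eight vectors have the same coordinate determinant modulo `3` as `frame`? -/
def sameDet (ws : List (List ℤ)) : Bool := detModThree 8 (ws.map dropFirst) % 3 == 2

/-- The computational core. The first image is restricted to one representative of each orbit; the
other seven range over all vectors of norm 4. -/
theorem search_frame :
    search sameDet 8 [] (frame.zip ([rootA, rootB] :: List.replicate 7 (orbitA ++ orbitB))) =
      true := by
  decide +kernel

/-! ### Classification of the vectors of norm 4. -/

/-- All lists of length `m` with terms in `{-1, 0, 1}`. -/
def cube : ℕ → List (List ℤ)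
  | 0 => [[]]
  | m + 1 => (cube m).flatMap fun t => [-1 :: t, 0 :: t, 1 :: t]

theorem cons_mem_cube {m : ℕ} {a : ℤ} {t : List ℤ} (ht : t ∈ cube m)
    (ha : a = -1 ∨ a = 0 ∨ a = 1) : a :: t ∈ cube (m + 1) := by
  simp only [cube, List.mem_flatMap]
  refine ⟨t, ht, ?_⟩
  rcases ha with rfl | rfl | rfl <;> simp

/-- The contribution of one block to the congruence modulo 5. -/
def weight : List ℤ → ℤ
  | [_, b, c, d, e] => b + 2 * c + 3 * d + 4 * e
  | _ => 0

theorem mem_orbit_of_mem_cube :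
    (((cube 5).filter fun t => t.sum == 0).all fun x =>
      ((cube 5).filter fun t => t.sum == 0).all fun y =>
        !(dot x x + dot y y == 4 && (weight x + weight y) % 5 == 0) ||
          (orbitA ++ orbitB).elem (x ++ y)) = true := by
  decide +kernel

/-- By Cauchy–Schwarz, `a ^ 2 = (b + c + d + e) ^ 2` is at most four times the sum of the other
squares, so `5 * a ^ 2 ≤ 16`. -/
theorem eq_of_sum_sq_le {a b c d e : ℤ} (h : a + b + c + d + e = 0)
    (h' : a * a + b * b + c * c + d * d + e * e ≤ 4) : a = -1 ∨ a = 0 ∨ a = 1 := by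
  have h1 : a < 2 := by
    nlinarith [sq_nonneg (b - c), sq_nonneg (b - d), sq_nonneg (b - e), sq_nonneg (c - d),
      sq_nonneg (c - e), sq_nonneg (d - e)]
  have h2 : -2 < a := by
    nlinarith [sq_nonneg (b - c), sq_nonneg (b - d), sq_nonneg (b - e), sq_nonneg (c - d),
      sq_nonneg (c - e), sq_nonneg (d - e)]
  omega

theorem mem_cube_of_sum_sq_le {a b c d e : ℤ} (h : a + b + c + d + e = 0)
    (h' : a * a + b * b + c * c + d * d + e * e ≤ 4) :
    [a, b, c, d, e] ∈ (cube 5).filter fun t => t.sum == 0 := by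
  refine List.mem_filter.2 ⟨?_, ?_⟩
  · refine cons_mem_cube (cons_mem_cube (cons_mem_cube (cons_mem_cube (cons_mem_cube
      (by simp [cube]) ?_) ?_) ?_) ?_) ?_
    · exact eq_of_sum_sq_le (b := a) (c := b) (d := c) (e := d) (by linarith) (by linarith)
    · exact eq_of_sum_sq_le (b := a) (c := b) (d := c) (e := e) (by linarith) (by linarith)
    · exact eq_of_sum_sq_le (b := a) (c := b) (d := d) (e := e) (by linarith) (by linarith)
    · exact eq_of_sum_sq_le (b := a) (c := c) (d := d) (e := e) (by linarith) (by linarith)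
    · exact eq_of_sum_sq_le h h'
  · simp only [List.sum_cons, List.sum_nil, beq_iff_eq]
    linarith

/-- The list of the coordinates of a vector. -/
def coordList (z : Fin 2 × Fin 5 → ℤ) : List ℤ :=
  [z (0, 0), z (0, 1), z (0, 2), z (0, 3), z (0, 4), z (1, 0), z (1, 1), z (1, 2), z (1, 3),
    z (1, 4)]

theorem dot_coordList (x y : Fin 2 × Fin 5 → ℤ) :
    dot (coordList x) (coordList y) = ∑ q, x q * y q := by
  simp only [coordList, dot, Fintype.sum_prod_type, Fin.sum_univ_two, Fin.sum_univ_five]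
  ring

theorem mem_modelLattice_two_five {z : Fin 2 × Fin 5 → ℤ} :
    z ∈ modelLattice 2 5 5 ↔
      z (0, 0) + z (0, 1) + z (0, 2) + z (0, 3) + z (0, 4) = 0 ∧
      z (1, 0) + z (1, 1) + z (1, 2) + z (1, 3) + z (1, 4) = 0 ∧
      5 ∣ z (0, 1) + 2 * z (0, 2) + 3 * z (0, 3) + 4 * z (0, 4) +
        (z (1, 1) + 2 * z (1, 2) + 3 * z (1, 3) + 4 * z (1, 4)) := by
  change (_ ∧ _) ↔ _
  simp [Fin.forall_fin_two, Fin.sum_univ_two, Fin.sum_univ_five, and_assoc]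

theorem coordList_mem_orbit {z : Fin 2 × Fin 5 → ℤ} (hz : z ∈ modelLattice 2 5 5)
    (h : dot (coordList z) (coordList z) = 4) : coordList z ∈ orbitA ++ orbitB := by
  obtain ⟨h0, h1, h2⟩ := mem_modelLattice_two_five.1 hz
  simp only [coordList, dot] at h
  have hx := mem_cube_of_sum_sq_le h0 (by
    nlinarith [mul_self_nonneg (z (1, 0)), mul_self_nonneg (z (1, 1)), mul_self_nonneg (z (1, 2)),
      mul_self_nonneg (z (1, 3)), mul_self_nonneg (z (1, 4))])
  have hy := mem_cube_of_sum_sq_le h1 (by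
    nlinarith [mul_self_nonneg (z (0, 0)), mul_self_nonneg (z (0, 1)), mul_self_nonneg (z (0, 2)),
      mul_self_nonneg (z (0, 3)), mul_self_nonneg (z (0, 4))])
  have hall := List.all_eq_true.1 (List.all_eq_true.1 mem_orbit_of_mem_cube _ hx) _ hy
  have hcond : (dot [z (0, 0), z (0, 1), z (0, 2), z (0, 3), z (0, 4)]
        [z (0, 0), z (0, 1), z (0, 2), z (0, 3), z (0, 4)] +
      dot [z (1, 0), z (1, 1), z (1, 2), z (1, 3), z (1, 4)]
        [z (1, 0), z (1, 1), z (1, 2), z (1, 3), z (1, 4)] == 4 &&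
      (weight [z (0, 0), z (0, 1), z (0, 2), z (0, 3), z (0, 4)] +
        weight [z (1, 0), z (1, 1), z (1, 2), z (1, 3), z (1, 4)]) % 5 == 0) = true := by
    simp only [Bool.and_eq_true, beq_iff_eq, dot, weight]
    exact ⟨by linarith, Int.emod_eq_zero_of_dvd h2⟩
  rw [hcond, Bool.not_true, Bool.false_or] at hall
  exact List.elem_iff.1 hall

/-! ### Determinants of the isometries of `Q8`. -/

/-- The coordinates of the model of `Q₈` other than the first one of each block. -/
def coordsEight : modelLattice 2 5 5 →ₗ[ℤ] (Fin 8 → ℤ) where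
  toFun z j := (z : Fin 2 × Fin 5 → ℤ)
    (![(0, 1), (0, 2), (0, 3), (0, 4), (1, 1), (1, 2), (1, 3), (1, 4)] j)
  map_add' _ _ := rfl
  map_smul' _ _ := rfl

theorem coordsEight_injective : Function.Injective coordsEight := by
  rw [← LinearMap.ker_eq_bot, LinearMap.ker_eq_bot']
  rintro ⟨z, hz⟩ h
  obtain ⟨h0, h1, -⟩ := mem_modelLattice_two_five.1 hz
  have e1 : z (0, 1) = 0 := congrFun h 0
  have e2 : z (0, 2) = 0 := congrFun h 1
  have e3 : z (0, 3) = 0 := congrFun h 2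
  have e4 : z (0, 4) = 0 := congrFun h 3
  have e5 : z (1, 1) = 0 := congrFun h 4
  have e6 : z (1, 2) = 0 := congrFun h 5
  have e7 : z (1, 3) = 0 := congrFun h 6
  have e8 : z (1, 4) = 0 := congrFun h 7
  have e0 : z (0, 0) = 0 := by linarith
  have e9 : z (1, 0) = 0 := by linarith
  ext ⟨c, i⟩
  fin_cases c <;> fin_cases i <;> assumption

theorem coordsEight_apply (z : modelLattice 2 5 5) (j : Fin 8) :
    coordsEight z j = (dropFirst (coordList z)).getD j 0 := by
  fin_cases j <;> rfl

/-- The vectors of `frame` as elements of the model of `Q₈`. -/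
def frameVec (j : Fin 8) : modelLattice 2 5 5 :=
  ⟨fun q => (frame.getD j []).getD (5 * q.1 + q.2) 0, by
    rw [mem_modelLattice_two_five]
    revert j
    decide⟩

theorem coordList_frameVec (j : Fin 8) : coordList (frameVec j) = frame.getD j [] := by
  fin_cases j <;> rfl

theorem det_coordsEight {v : Fin 8 → modelLattice 2 5 5}
    (h : sameDet ((List.finRange 8).map fun j => coordList (v j)) = true) :
    (((Matrix.of fun i j => coordsEight (v i) j).det : ℤ) : ZMod 3) = 2 := by
  set rows := ((List.finRange 8).map fun j => coordList (v j)).map dropFirst with hrows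
  have h1 : (detModThree 8 rows : ZMod 3) = 2 := by
    rw [sameDet, beq_iff_eq] at h
    rw [← intCast_emod_three]
    exact congrArg (Int.cast : ℤ → ZMod 3) h
  have h2 := detModThree_eq_det 8 rows (by simp [hrows]) (by
    intro r hr
    simp only [hrows, List.map_map, List.mem_map] at hr
    obtain ⟨j, -, rfl⟩ := hr
    rfl) (by rw [h1]; decide)
  rw [h1] at h2
  rw [← h2, Int.cast_det]
  congr 1
  ext i j
  simp only [Matrix.map_apply, Matrix.of_apply, coordsEight_apply]
  have : rows.getD i [] = dropFirst (coordList (v i)) := by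
    rw [List.getD_eq_getElem _ _ (by simp [hrows])]
    simp [hrows]
  rw [this]

/-- The frame itself passes the test `sameDet`, so its determinant and that of its image are both
`2` modulo 3, which can be cancelled. -/
theorem det_eq_one_of_sameDet {f : modelLattice 2 5 5 →ₗ[ℤ] modelLattice 2 5 5}
    (h : sameDet ((List.finRange 8).map fun j => coordList (f (frameVec j))) = true) :
    ((LinearMap.det f : ℤ) : ZMod 3) = 1 := by
  have h0 := det_coordsEight (v := frameVec) (by
    simp only [coordList_frameVec]
    decide +kernel)
  have h1 := det_coordsEight h
  rw [det_coord_comp coordsEight coordsEight_injective frameVec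
    (fun h => by rw [h] at h0; revert h0; decide) f, Int.cast_mul, h0] at h1
  revert h1
  generalize ((LinearMap.det f : ℤ) : ZMod 3) = t
  revert t
  decide

/-- The isometries that send the first vector of `frame` to `t` have determinant `1` modulo `3`. -/
def Good (t : List ℤ) : Prop :=
  ∀ f : modelLattice 2 5 5 →ₗ[ℤ] modelLattice 2 5 5,
    (∀ x y, modelForm 2 5 5 (f x) (f y) = modelForm 2 5 5 x y) →
    coordList (f (frameVec 0)) = t → ((LinearMap.det f : ℤ) : ZMod 3) = 1

theorem dot_coordList_map {f : modelLattice 2 5 5 →ₗ[ℤ] modelLattice 2 5 5}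
    (hf : ∀ x y, modelForm 2 5 5 (f x) (f y) = modelForm 2 5 5 x y) (x y : modelLattice 2 5 5) :
    dot (coordList (f x)) (coordList (f y)) = dot (coordList x) (coordList y) := by
  rw [dot_coordList, dot_coordList]
  exact hf x y

theorem coordList_map_frameVec_mem {f : modelLattice 2 5 5 →ₗ[ℤ] modelLattice 2 5 5}
    (hf : ∀ x y, modelForm 2 5 5 (f x) (f y) = modelForm 2 5 5 x y) (j : Fin 8) :
    coordList (f (frameVec j)) ∈ orbitA ++ orbitB := by
  apply coordList_mem_orbit (f (frameVec j)).2
  rw [dot_coordList_map hf, coordList_frameVec]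
  revert j
  decide

theorem good_of_mem_roots {t : List ℤ} (ht : t ∈ [rootA, rootB]) : Good t := by
  intro f hf hft
  apply det_eq_one_of_sameDet
  have h := leaf_of_search (leaf := sameDet) 8 []
    ((List.finRange 8).map fun j => (coordList (frameVec j),
      (if j = 0 then [rootA, rootB] else orbitA ++ orbitB), coordList (f (frameVec j))))
    (by simp)
    (by
      intro s hs
      obtain ⟨j, -, rfl⟩ := List.mem_map.1 hs
      dsimp only
      split_ifs with hj
      · rw [hj, hft]
        exact ht
      · exact coordList_map_frameVec_mem hf j)
    (by
      rw [List.pairwise_map]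
      exact List.pairwise_of_forall fun i j => dot_coordList_map hf _ _)
    (by
      rw [← search_frame]
      congr 1)
  simpa [Function.comp_def] using h

/-! ### Reduction to one representative per orbit. -/

/-- The linear map underlying `act σ`. -/
def actMap (σ : List (ℤ × ℕ)) : (Fin 2 × Fin 5 → ℤ) →ₗ[ℤ] (Fin 2 × Fin 5 → ℤ) where
  toFun z q := (σ.getD (5 * q.1 + q.2) (0, 0)).1 *
    z (Fin.ofNat 2 ((σ.getD (5 * q.1 + q.2) (0, 0)).2 / 5),
      Fin.ofNat 5 ((σ.getD (5 * q.1 + q.2) (0, 0)).2))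
  map_add' x y := by
    ext q
    exact mul_add _ _ _
  map_smul' a x := by
    ext q
    exact mul_left_comm _ _ _

/-- `act σ` is an isometry of the model of `Q₈` of determinant `1` modulo `3`. -/
structure IsSymmetry (σ : List (ℤ × ℕ)) : Prop where
  mem : ∀ z ∈ modelLattice 2 5 5, actMap σ z ∈ modelLattice 2 5 5
  dot_act : ∀ x y, dot (act σ (coordList x)) (act σ (coordList y)) =
    dot (coordList x) (coordList y)
  coordList_actMap : ∀ z, coordList (actMap σ z) = act σ (coordList z)
  sameDet_frame : sameDet (frame.map (act σ)) = true

/-- If `f` sends the first frame vector to `t`, then the composite of `f` with the symmetry sends it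
to `act σ t` and has the same determinant modulo 3. -/
theorem IsSymmetry.good {σ : List (ℤ × ℕ)} (hσ : IsSymmetry σ) {t : List ℤ}
    (ht : Good (act σ t)) : Good t := by
  intro f hf hft
  let S : modelLattice 2 5 5 →ₗ[ℤ] modelLattice 2 5 5 := (actMap σ).restrict hσ.mem
  have hS : ∀ z, coordList (S z) = act σ (coordList z) := fun z => hσ.coordList_actMap z
  have h1 : ((LinearMap.det S : ℤ) : ZMod 3) = 1 := by
    apply det_eq_one_of_sameDet
    simp only [hS, coordList_frameVec]
    exact hσ.sameDet_frame
  have h2 := ht (S ∘ₗ f) (fun x y => by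
    rw [← hf x y, modelForm_apply, modelForm_apply, ← dot_coordList, ← dot_coordList,
      LinearMap.comp_apply, LinearMap.comp_apply, hS, hS, hσ.dot_act]) (by
    rw [LinearMap.comp_apply, hS, hft])
  rwa [LinearMap.det_comp, Int.cast_mul, h1, one_mul] at h2

theorem isSymmetry_shiftLeft : IsSymmetry shiftLeft where
  mem z hz := by
    rw [mem_modelLattice_two_five] at hz ⊢
    simp [actMap, shiftLeft, Fin.ofNat] at hz ⊢
    -- A cyclic shift changes the weighted sum of a block by its block sum, which is zero, and by
    -- multiples of 5.
    omega
  dot_act x y := by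
    simp [act, shiftLeft, dot, coordList]
    ring
  coordList_actMap z := by
    simp [actMap, act, shiftLeft, coordList, Fin.ofNat]
  sameDet_frame := by decide +kernel

theorem isSymmetry_shiftRight : IsSymmetry shiftRight where
  mem z hz := by
    rw [mem_modelLattice_two_five] at hz ⊢
    simp [actMap, shiftRight, Fin.ofNat] at hz ⊢
    omega
  dot_act x y := by
    simp [act, shiftRight, dot, coordList]
    ring
  coordList_actMap z := by
    simp [actMap, act, shiftRight, coordList, Fin.ofNat]
  sameDet_frame := by decide +kernel

theorem isSymmetry_doubleIndex : IsSymmetry doubleIndex where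
  mem z hz := by
    rw [mem_modelLattice_two_five] at hz ⊢
    simp [actMap, doubleIndex, Fin.ofNat] at hz ⊢
    omega
  dot_act x y := by
    simp [act, doubleIndex, dot, coordList]
    ring
  coordList_actMap z := by
    simp [actMap, act, doubleIndex, coordList, Fin.ofNat]
  sameDet_frame := by decide +kernel

theorem isSymmetry_negLeft : IsSymmetry negLeft where
  mem z hz := by
    rw [mem_modelLattice_two_five] at hz ⊢
    simp [actMap, negLeft, Fin.ofNat] at hz ⊢
    omega
  dot_act x y := by
    simp [act, negLeft, dot, coordList]
    ring
  coordList_actMap z := by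
    simp [actMap, act, negLeft, coordList, Fin.ofNat]
  sameDet_frame := by decide +kernel

theorem isSymmetry_swapBlocks : IsSymmetry swapBlocks where
  mem z hz := by
    rw [mem_modelLattice_two_five] at hz ⊢
    simp [actMap, swapBlocks, Fin.ofNat] at hz ⊢
    omega
  dot_act x y := by
    simp [act, swapBlocks, dot, coordList]
    ring
  coordList_actMap z := by
    simp [actMap, act, swapBlocks, coordList, Fin.ofNat]
  sameDet_frame := by decide +kernel

theorem good_of_mem_orbitA : ∀ t ∈ orbitA, Good t :=
  forall_expand (fun _ => isSymmetry_swapBlocks.good)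
    (forall_expand (fun _ => isSymmetry_negLeft.good)
      (forall_expand (fun _ => isSymmetry_shiftLeft.good)
        (fun _ h => good_of_mem_roots (by simp_all)) (by decide +kernel))
      (by decide +kernel))
    (by decide +kernel)

theorem good_of_mem_orbitB : ∀ t ∈ orbitB, Good t :=
  forall_expand (fun _ => isSymmetry_shiftRight.good)
    (forall_expand (fun _ => isSymmetry_shiftLeft.good)
      (forall_expand (fun _ => isSymmetry_doubleIndex.good)
        (fun _ h => good_of_mem_roots (by simp_all)) (by decide +kernel))
      (by decide +kernel))
    (by decide +kernel)

theorem orientable_Q8 {ρ : EuclideanSpace ℝ (Fin 2 × Fin 5)}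
    (hρ : IsWeylVector (rootsA 2 5) ρ) : Orientable (Q8 ρ) := by
  rw [Q8, orientable_weylSublattice_iff 5 hρ]
  intro g hg
  have hgood : Good (coordList (g (frameVec 0))) := by
    rcases List.mem_append.1 (coordList_map_frameVec_mem (f := g) hg 0) with h | h
    · exact good_of_mem_orbitA _ h
    · exact good_of_mem_orbitB _ h
  have h1 := hgood g hg rfl
  -- The determinant of an automorphism is a unit of `ℤ`, and `1` and `-1` differ modulo 3.
  rcases Int.isUnit_iff.1 (LinearEquiv.isUnit_det' g) with h | h
  · exact h
  · rw [h] at h1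
    exact absurd h1 (by decide)

end LatticeQ

end

theorem mainTheorem12 :
    (∀ ρ : EuclideanSpace ℝ (Fin 2 × Fin 5),
      LatticeQ.IsWeylVector (LatticeQ.rootsA 2 5) ρ → LatticeQ.Orientable (LatticeQ.Q8 ρ)) ∧
    (∀ ρ : EuclideanSpace ℝ (Fin 3 × Fin 3),
      LatticeQ.IsWeylVector (LatticeQ.rootsA 3 3) ρ → ¬ LatticeQ.Orientable (LatticeQ.Q6 ρ)) := by
  exact ⟨fun _ => LatticeQ.orientable_Q8, fun _ => LatticeQ.not_orientable_Q6⟩
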